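/- Let $(M,\mathrm g)$ be a smooth finite-dimensional Riemannian manifold without boundary (completeness is not needed), with Levi--Civita connection $\nabla$. For smooth vector fields $X,Y,Z$ put $$\operatorname{Riem}(X,Y)Z:=\nabla_Y\nabla_XZ-\nabla_X\nabla_YZ+\nabla_{[X,Y]}Z .$$ For a smooth function $\psi:M\to\mathbb R$ let $\nabla\psi$ be its gradient, let $\nabla^2\psi(x):T_xM\to T_xM$, $v\mapsto\nabla_v\nabla\psi$, be its Hessian viewed as an endomorphism field, and let $\nabla_{\nabla\psi}\nabla^2\psi$ be the covariant derivative of this endomorphism field in the direction $\nabla\psi$, that is, $(\nabla_{\nabla\psi}\nabla^2\psi)V=\nabla_{\nabla\psi}\big((\nabla^2\psi)V\big)-(\nabla^2\psi)\nabla_{\nabla\psi}V$ for every smooth vector field $V$. Then for every smooth $\psi:M\to\mathbb R$ and every $x\in M$ one has, as endomorphisms of $T_xM$, $$-\tfrac12\nabla^2|\nabla\psi|^2+\nabla_{\nabla\psi}\nabla^2\psi+(\nabla^2\psi)^2+\operatorname{Riem}(\nabla\psi,\cdot)\nabla\psi=0,$$ all terms being evaluated at $x$, where $(\nabla^2\psi)^2$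 is the composition of $\nabla^2\psi$ with itself. Consequently the tensorial Bakry--\'Emery operator $\tilde\Gamma_2(\psi):=\tfrac12\nabla^2|\nabla\psi|^2-\nabla_{\nabla\psi}\nabla^2\psi$ satisfies $$\tilde\Gamma_2(\psi)=(\nabla^2\psi)^2+\operatorname{Riem}(\nabla\psi,\cdot)\nabla\psi .$$ -/

import Mathlib

open Bundle Manifold ContDiff

set_option linter.unusedSectionVars false

noncomputable section

namespace RiemannianGeometry

variable {E : Type*} [NormedAddCommGroup E] [NormedSpace ℝ E] [FiniteDimensional ℝ E]
  {H : Type*} [TopologicalSpace H] {I : ModelWithCorners ℝ E H}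
  {M : Type*} [TopologicalSpace M] [ChartedSpace H M] [IsManifold I ∞ M]
  [RiemannianBundle (fun (x : M) ↦ TangentSpace I x)]

instance instFiniteDimensionalTangentSpace (x : M) : FiniteDimensional ℝ (TangentSpace I x) :=
  inferInstanceAs (FiniteDimensional ℝ E)

instance instCompleteSpaceTangentSpace (x : M) : CompleteSpace (TangentSpace I x) :=
  FiniteDimensional.complete ℝ (TangentSpace I x)

variable (I) in
/-- The gradient `∇ψ`: the vector field with `g_x(∇ψ(x), v) = dψ_x(v)` for all `v ∈ T_xM`. -/
def grad (ψ : M → ℝ) (x : M) : TangentSpace I x :=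
  (InnerProductSpace.toDual ℝ (TangentSpace I x)).symm (d% ψ x)

/-- The right-hand side of the Koszul formula for `2 g(∇_X Y, Z)` (note the order `Y X Z` of the
arguments); it is tensorial in `X` and `Z`. -/
def koszul (Y X Z : Π x : M, TangentSpace I x) (x : M) : ℝ :=
  d% (fun y ↦ inner ℝ (Y y) (Z y)) x (X x) + d% (fun y ↦ inner ℝ (Z y) (X y)) x (Y x)
    - d% (fun y ↦ inner ℝ (X y) (Y y)) x (Z x)
    + inner ℝ (VectorField.mlieBracket I X Y x) (Z x)
    - inner ℝ (VectorField.mlieBracket I X Z x) (Y x)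
    - inner ℝ (VectorField.mlieBracket I Y Z x) (X x)

variable [IsContMDiffRiemannianBundle I ∞ E (fun (x : M) ↦ TangentSpace I x)]

theorem mdifferentiableAt_inner {x : M} {X Y : Π x : M, TangentSpace I x}
    (hX : MDiffAt (T% X) x) (hY : MDiffAt (T% Y) x) :
    MDiffAt (fun y ↦ (inner ℝ (X y) (Y y) : ℝ)) x :=
  MDifferentiableAt.inner_bundle (F := E) (E := fun (x : M) ↦ TangentSpace I x) hX hY

theorem mvfderiv_inner_add {x : M} {X X' Y : Π x : M, TangentSpace I x}
    (hX : MDiffAt (T% X) x) (hX' : MDiffAt (T% X') x) (hY : MDiffAt (T% Y) x) :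
    d% (fun y ↦ (inner ℝ ((X + X') y) (Y y) : ℝ)) x =
      d% (fun y ↦ (inner ℝ (X y) (Y y) : ℝ)) x + d% (fun y ↦ (inner ℝ (X' y) (Y y) : ℝ)) x := by
  simp only [Pi.add_apply, inner_add_left]
  exact mvfderiv_fun_add (mdifferentiableAt_inner hX hY) (mdifferentiableAt_inner hX' hY)

theorem mvfderiv_inner_smul {x : M} {f : M → ℝ} {X Y : Π x : M, TangentSpace I x}
    (hf : MDiffAt f x) (hX : MDiffAt (T% X) x) (hY : MDiffAt (T% Y) x) :
    d% (fun y ↦ (inner ℝ ((f • X) y) (Y y) : ℝ)) x =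
      f x • d% (fun y ↦ (inner ℝ (X y) (Y y) : ℝ)) x + (inner ℝ (X x) (Y x) : ℝ) • d% f x := by
  simp only [Pi.smul_apply', real_inner_smul_left]
  exact mvfderiv_fun_mul hf (mdifferentiableAt_inner hX hY)

theorem mvfderiv_inner_comm (X Y : Π x : M, TangentSpace I x) (x : M) :
    d% (fun y ↦ (inner ℝ (X y) (Y y) : ℝ)) x = d% (fun y ↦ (inner ℝ (Y y) (X y) : ℝ)) x := by
  simp only [real_inner_comm]

theorem koszul_tensorial_left {x : M} {Y Z : Π x : M, TangentSpace I x}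
    (hY : MDiffAt (T% Y) x) (hZ : MDiffAt (T% Z) x) :
    TensorialAt I E (fun X ↦ koszul Y X Z x) x where
  smul {f X} hf hX := by
    have : CompleteSpace E := FiniteDimensional.complete ℝ E
    simp only [koszul, mvfderiv_inner_comm Z, mvfderiv_inner_smul hf hX hY,
      mvfderiv_inner_smul hf hX hZ, VectorField.mlieBracket_smul_left hf hX]
    simp [inner_smul_left, inner_smul_right, inner_add_left, real_inner_comm]
    ring
  add {X X'} hX hX' := by
    have : CompleteSpace E := FiniteDimensional.complete ℝ E
    simp only [koszul, mvfderiv_inner_comm Z, mvfderiv_inner_add hX hX' hY,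
      mvfderiv_inner_add hX hX' hZ, VectorField.mlieBracket_add_left hX hX']
    simp [inner_add_left, inner_add_right]
    ring

theorem koszul_tensorial_right {x : M} {Y X : Π x : M, TangentSpace I x}
    (hY : MDiffAt (T% Y) x) (hX : MDiffAt (T% X) x) :
    TensorialAt I E (fun Z ↦ koszul Y X Z x) x where
  smul {f Z} hf hZ := by
    have : CompleteSpace E := FiniteDimensional.complete ℝ E
    simp only [koszul, mvfderiv_inner_comm Y, mvfderiv_inner_smul hf hZ hY,
      mvfderiv_inner_smul hf hZ hX, VectorField.mlieBracket_smul_right hf hZ]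
    simp [inner_smul_left, inner_smul_right, inner_add_left, real_inner_comm]
    ring
  add {Z Z'} hZ hZ' := by
    have : CompleteSpace E := FiniteDimensional.complete ℝ E
    simp only [koszul, mvfderiv_inner_comm Y, mvfderiv_inner_add hZ hZ' hY,
      mvfderiv_inner_add hZ hZ' hX, VectorField.mlieBracket_add_right hZ hZ']
    simp [inner_add_left, inner_add_right]
    ring

open Classical in
/-- `v ↦ ∇_v Y ∈ T_xM`, given by the Koszul formula if `Y` is differentiable at `x` (and `0`
otherwise). -/
def leviCivitaFun (Y : Π x : M, TangentSpace I x) (x : M) :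
    TangentSpace I x →L[ℝ] TangentSpace I x :=
  if hY : MDiffAt (T% Y) x then
    (1 / 2 : ℝ) • ((InnerProductSpace.toDual ℝ
        (TangentSpace I x)).symm.toContinuousLinearEquiv.toContinuousLinearMap ∘L
      TensorialAt.mkHom₂ (fun X Z ↦ koszul Y X Z x) x
        (fun _ hZ ↦ koszul_tensorial_left hY hZ) (fun _ hX ↦ koszul_tensorial_right hY hX))
  else 0

theorem two_inner_leviCivitaFun {x : M} {X Y Z : Π x : M, TangentSpace I x}
    (hX : MDiffAt (T% X) x) (hY : MDiffAt (T% Y) x) (hZ : MDiffAt (T% Z) x) :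
    2 * inner ℝ (leviCivitaFun Y x (X x)) (Z x) = koszul Y X Z x := by
  have h := TensorialAt.mkHom₂_apply (Φ := fun X Z ↦ koszul Y X Z x)
    (fun _ hZ ↦ koszul_tensorial_left hY hZ) (fun _ hX ↦ koszul_tensorial_right hY hX) hX hZ
  rw [← h]
  simp [leviCivitaFun, hY, inner_smul_left]

theorem ext_leviCivita {x : M} {A B : TangentSpace I x →L[ℝ] TangentSpace I x}
    (h : ∀ X Z : Π x : M, TangentSpace I x, MDiffAt (T% X) x → MDiffAt (T% Z) x →
      2 * inner ℝ (A (X x)) (Z x) = 2 * inner ℝ (B (X x)) (Z x)) : A = B := by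
  ext v
  refine ext_inner_right ℝ fun w ↦ ?_
  simpa using h (FiberBundle.extend E v) (FiberBundle.extend E w)
    (FiberBundle.mdifferentiableAt_extend ..)
      (FiberBundle.mdifferentiableAt_extend ..)

variable (I M) in
/-- The Levi-Civita connection; `leviCivita I M Y x v` is `(∇_v Y)(x)`. -/
def leviCivita : CovariantDerivative I E (fun x : M ↦ TangentSpace I x) where
  toFun := leviCivitaFun
  isCovariantDerivativeOnUniv :=
    { add := by
        intro Y Y' x hY hY' _
        have : CompleteSpace E := FiniteDimensional.complete ℝ E
        have hYY : MDiffAt (T% (Y + Y')) x := mdifferentiableAt_add_section hY hY'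
        refine ext_leviCivita fun X Z hX hZ ↦ ?_
        rw [_root_.add_apply, inner_add_left, mul_add,
          two_inner_leviCivitaFun hX hY hZ, two_inner_leviCivitaFun hX hY' hZ,
          two_inner_leviCivitaFun hX hYY hZ]
        simp only [koszul, mvfderiv_inner_comm X, mvfderiv_inner_add hY hY' hX,
          mvfderiv_inner_add hY hY' hZ, VectorField.mlieBracket_add_left hY hY',
          VectorField.mlieBracket_add_right hY hY']
        simp [inner_add_left, inner_add_right]
        ring
      leibniz := by
        intro Y f x hY hf _
        have : CompleteSpace E := FiniteDimensional.complete ℝ E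
        have hfY : MDiffAt (T% (f • Y)) x := hf.smul_section hY
        refine ext_leviCivita fun X Z hX hZ ↦ ?_
        rw [_root_.add_apply, inner_add_left, mul_add,
          _root_.smul_apply, real_inner_smul_left, mul_left_comm,
          two_inner_leviCivitaFun hX hY hZ, two_inner_leviCivitaFun hX hfY hZ]
        simp only [koszul, mvfderiv_inner_comm X, mvfderiv_inner_smul hf hY hX,
          mvfderiv_inner_smul hf hY hZ, VectorField.mlieBracket_smul_left hf hY,
          VectorField.mlieBracket_smul_right hf hY]
        simp [inner_smul_left, inner_smul_right, inner_add_left, real_inner_comm]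
        ring }

/-- The Levi-Civita connection is compatible with the metric. -/
theorem leviCivita_metric {x : M} {X Y Z : Π x : M, TangentSpace I x}
    (hX : MDiffAt (T% X) x) (hY : MDiffAt (T% Y) x) (hZ : MDiffAt (T% Z) x) :
    d% (fun y ↦ (inner ℝ (Y y) (Z y) : ℝ)) x (X x) =
      inner ℝ (leviCivita I M Y x (X x)) (Z x) + inner ℝ (Y x) (leviCivita I M Z x (X x)) := by
  have h1 : 2 * inner ℝ (leviCivita I M Y x (X x)) (Z x) = koszul Y X Z x :=
    two_inner_leviCivitaFun hX hY hZ
  have h2 : 2 * inner ℝ (leviCivita I M Z x (X x)) (Y x) = koszul Z X Y x :=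
    two_inner_leviCivitaFun hX hZ hY
  rw [koszul] at h1 h2
  rw [mvfderiv_inner_comm Z Y, mvfderiv_inner_comm Y X, mvfderiv_inner_comm X Z,
    VectorField.mlieBracket_swap_apply (V := Z), inner_neg_left] at h2
  rw [real_inner_comm _ (Y x)]
  linarith

/-- The Levi-Civita connection is torsion-free. -/
theorem leviCivita_torsion {x : M} {X Y : Π x : M, TangentSpace I x}
    (hX : MDiffAt (T% X) x) (hY : MDiffAt (T% Y) x) :
    leviCivita I M Y x (X x) - leviCivita I M X x (Y x) = VectorField.mlieBracket I X Y x := by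
  refine ext_inner_right ℝ fun w ↦ ?_
  have hZ : MDiffAt (T% (FiberBundle.extend E w : Π x : M, TangentSpace I x)) x :=
    FiberBundle.mdifferentiableAt_extend ..
  have h1 : 2 * inner ℝ (leviCivita I M Y x (X x)) (FiberBundle.extend E w x) = _ :=
    two_inner_leviCivitaFun hX hY hZ
  have h2 : 2 * inner ℝ (leviCivita I M X x (Y x)) (FiberBundle.extend E w x) = _ :=
    two_inner_leviCivitaFun hY hX hZ
  set Z : Π x : M, TangentSpace I x := FiberBundle.extend E w
  have hZw : Z x = w := by simp [Z]
  rw [koszul] at h1 h2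
  rw [mvfderiv_inner_comm X Z, mvfderiv_inner_comm Z Y, mvfderiv_inner_comm Y X,
    VectorField.mlieBracket_swap_apply (V := Y) (W := X), inner_neg_left] at h2
  rw [← hZw]
  rw [inner_sub_left]
  linarith

variable (I) in
/-- Differentiability at `x` of a field `S` of endomorphisms of the tangent spaces. -/
abbrev EndMDiffAt (S : Π x : M, TangentSpace I x →L[ℝ] TangentSpace I x) (x : M) : Prop :=
  MDifferentiableAt I (I.prod 𝓘(ℝ, E →L[ℝ] E)) (fun y ↦ TotalSpace.mk' (E →L[ℝ] E)
    (E := fun y : M ↦ (TangentSpace I y →L[ℝ] TangentSpace I y)) y (S y)) x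

theorem EndMDiffAt.apply {S : Π x : M, TangentSpace I x →L[ℝ] TangentSpace I x} {x : M}
    (hS : EndMDiffAt I S x) {V : Π x : M, TangentSpace I x} (hV : MDiffAt (T% V) x) :
    MDiffAt (T% (fun y ↦ S y (V y))) x := by
  exact MDifferentiableAt.clm_bundle_apply (F₁ := E) (F₂ := E)
    (E₁ := fun y : M ↦ TangentSpace I y) (E₂ := fun y : M ↦ TangentSpace I y) hS hV

theorem covDerivEnd_tensorial {S : Π x : M, TangentSpace I x →L[ℝ] TangentSpace I x} {x : M}
    (hS : EndMDiffAt I S x) (u : TangentSpace I x) :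
    TensorialAt I E (fun V ↦ leviCivita I M (fun y ↦ S y (V y)) x u
      - S x (leviCivita I M V x u)) x where
  smul {f V} hf hV := by
    have h : (fun y ↦ S y ((f • V) y)) = f • fun y ↦ S y (V y) := by
      ext y; simp
    rw [h, (leviCivita I M).isCovariantDerivativeOn.leibniz (hS.apply hV) hf (Set.mem_univ x),
      (leviCivita I M).isCovariantDerivativeOn.leibniz hV hf (Set.mem_univ x)]
    simp [smul_sub]
  add {V V'} hV hV' := by
    have h : (fun y ↦ S y ((V + V') y)) = (fun y ↦ S y (V y)) + fun y ↦ S y (V' y) := by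
      ext y; simp
    rw [h, (leviCivita I M).isCovariantDerivativeOn.add (hS.apply hV) (hS.apply hV')
        (Set.mem_univ x),
      (leviCivita I M).isCovariantDerivativeOn.add hV hV' (Set.mem_univ x)]
    simp
    abel

open Classical in
/-- The covariant derivative `∇_u S` at `x` of an endomorphism field `S`, differentiable at `x`,
in the direction `u ∈ T_xM`: the endomorphism of `T_xM` with
`(∇_u S)(V) = ∇_u (S V) - S (∇_u V)` for every vector field `V`. -/
def covDerivEnd (S : Π x : M, TangentSpace I x →L[ℝ] TangentSpace I x) (x : M)
    (u : TangentSpace I x) : TangentSpace I x →L[ℝ] TangentSpace I x :=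
  if hS : EndMDiffAt I S x then TensorialAt.mkHom _ x (covDerivEnd_tensorial hS u) else 0

theorem covDerivEnd_apply {S : Π x : M, TangentSpace I x →L[ℝ] TangentSpace I x} {x : M}
    (hS : EndMDiffAt I S x) (u : TangentSpace I x) {V : Π x : M, TangentSpace I x}
    (hV : MDiffAt (T% V) x) :
    covDerivEnd S x u (V x) =
      leviCivita I M (fun y ↦ S y (V y)) x u - S x (leviCivita I M V x u) := by
  rw [covDerivEnd, dif_pos hS]
  exact TensorialAt.mkHom_apply (covDerivEnd_tensorial hS u) hV

/-- `Riem(X, Y) Z = ∇_Y ∇_X Z - ∇_X ∇_Y Z + ∇_[X,Y] Z` for vector fields `X`, `Y`, `Z`. -/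
def riemann (X Y Z : Π x : M, TangentSpace I x) (x : M) : TangentSpace I x :=
  leviCivita I M (fun y ↦ leviCivita I M Z y (X y)) x (Y x)
    - leviCivita I M (fun y ↦ leviCivita I M Z y (Y y)) x (X x)
    + leviCivita I M Z x (VectorField.mlieBracket I X Y x)

theorem riemann_tensorial {Z : Π x : M, TangentSpace I x} {x : M}
    (hZ : EndMDiffAt I (leviCivita I M Z) x) (X : Π x : M, TangentSpace I x) :
    TensorialAt I E (fun Y ↦ riemann X Y Z x) x where
  smul {f Y} hf hY := by
    have : CompleteSpace E := FiniteDimensional.complete ℝ E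
    have h : (fun y ↦ leviCivita I M Z y ((f • Y) y)) =
        f • fun y ↦ leviCivita I M Z y (Y y) := by
      ext y; simp
    rw [riemann, h, (leviCivita I M).isCovariantDerivativeOn.leibniz (hZ.apply hY) hf
      (Set.mem_univ x), VectorField.mlieBracket_smul_right hf hY]
    simp [riemann, smul_sub, smul_add]
    abel
  add {Y Y'} hY hY' := by
    have : CompleteSpace E := FiniteDimensional.complete ℝ E
    have h : (fun y ↦ leviCivita I M Z y ((Y + Y') y)) =
        (fun y ↦ leviCivita I M Z y (Y y)) + fun y ↦ leviCivita I M Z y (Y' y) := by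
      ext y; simp
    rw [riemann, h, (leviCivita I M).isCovariantDerivativeOn.add (hZ.apply hY) (hZ.apply hY')
      (Set.mem_univ x), VectorField.mlieBracket_add_right hY hY']
    simp [riemann]
    abel

open Classical in
/-- The endomorphism `Riem(X, ·) Z` of `T_xM`, for vector fields `X` and `Z` with `∇Z`
differentiable at `x`: it sends `Y(x)` to `(Riem(X, Y) Z)(x)`, for every vector field `Y`. -/
def riemannEnd (X Z : Π x : M, TangentSpace I x) (x : M) :
    TangentSpace I x →L[ℝ] TangentSpace I x :=
  if hZ : EndMDiffAt I (leviCivita I M Z) x then TensorialAt.mkHom _ x (riemann_tensorial hZ X)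
  else 0

theorem riemannEnd_apply {X Y Z : Π x : M, TangentSpace I x} {x : M}
    (hZ : EndMDiffAt I (leviCivita I M Z) x) (hY : MDiffAt (T% Y) x) :
    riemannEnd X Z x (Y x) = riemann X Y Z x := by
  rw [riemannEnd, dif_pos hZ]
  exact TensorialAt.mkHom_apply (riemann_tensorial hZ X) hY

variable (I) in
/-- The Hessian `∇²ψ` at `x`, as the endomorphism `v ↦ ∇_v ∇ψ` of `T_xM`. -/
def hess (ψ : M → ℝ) (x : M) : TangentSpace I x →L[ℝ] TangentSpace I x :=
  leviCivita I M (grad I ψ) x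

variable (I) in
/-- The tensorial Bakry-Émery operator `Γ̃₂(ψ) = ½ ∇²|∇ψ|² - ∇_{∇ψ} ∇²ψ`. -/
def tensorGamma2 (ψ : M → ℝ) (x : M) : TangentSpace I x →L[ℝ] TangentSpace I x :=
  (1 / 2 : ℝ) • hess I (fun y ↦ ‖grad I ψ y‖ ^ 2) x - covDerivEnd (hess I ψ) x (grad I ψ x)

end RiemannianGeometry

end

open RiemannianGeometry

namespace RiemannianGeometry

open Filter
open scoped Topology

section Smoothness

variable {E : Type*} [NormedAddCommGroup E] [NormedSpace ℝ E] [FiniteDimensional ℝ E]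
  {H : Type*} [TopologicalSpace H] {I : ModelWithCorners ℝ E H}
  {M : Type*} [TopologicalSpace M] [ChartedSpace H M] [IsManifold I ∞ M]

/-- The derivative of a smooth function along a smooth vector field is smooth. -/
theorem contMDiffAt_mvfderiv_apply {f : M → ℝ} {X : Π x : M, TangentSpace I x} {x : M}
    (hf : CMDiffAt ∞ f x) (hX : CMDiffAt ∞ (T% X) x) :
    CMDiffAt ∞ (fun y ↦ d% f y (X y)) x := by
  have h := ContMDiffAt.clm_apply_of_inCoordinates (b₁ := id) (b₂ := f) (n := ∞)
    (ϕ := fun y ↦ mfderiv% f y) (v := X) (m₀ := x)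
    (hf.mfderiv_const (m := ∞) (by simp)) hX hf
  rw [contMDiffAt_totalSpace] at h
  simpa using! h.2

/-- A field of endomorphisms is smooth if it maps smooth vector fields to smooth vector fields. -/
theorem contMDiffAt_end {S : Π x : M, TangentSpace I x →L[ℝ] TangentSpace I x} {x : M}
    (h : ∀ V : Π x : M, TangentSpace I x, CMDiffAt ∞ (T% V) x →
      CMDiffAt ∞ (T% (fun y ↦ S y (V y))) x) :
    ContMDiffAt I (I.prod 𝓘(ℝ, E →L[ℝ] E)) ∞ (fun y ↦ TotalSpace.mk' (E →L[ℝ] E)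
      (E := fun y : M ↦ (TangentSpace I y →L[ℝ] TangentSpace I y)) y (S y)) x := by
  rw [contMDiffAt_hom_bundle]
  refine ⟨contMDiffAt_id, ?_⟩
  set t := trivializationAt E (TangentSpace I (M := M)) x
  have hx : x ∈ t.baseSet := FiberBundle.mem_baseSet_trivializationAt' x
  let b := Module.finBasis ℝ E
  have key : ∀ i, CMDiffAt ∞ (fun y ↦ (t ⟨y, S y (t.localFrame b i y)⟩).2) x := fun i ↦ by
    have := h _ (contMDiffAt_localFrame_of_mem ∞ t b i hx)
    rw [contMDiffAt_section] at this
    exact this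
  have hsum : CMDiffAt ∞ (fun y ↦ ∑ i, (LinearMap.toContinuousLinearMap (b.coord i)).smulRight
      (t ⟨y, S y (t.localFrame b i y)⟩).2) x := by
    refine contMDiffAt_finsetSum fun i _ ↦ ?_
    exact (ContinuousLinearMap.contMDiff (ContinuousLinearMap.smulRightL ℝ E E
      (LinearMap.toContinuousLinearMap (b.coord i)))).contMDiffAt.comp x (key i)
  refine hsum.congr_of_eventuallyEq ?_
  filter_upwards [t.open_baseSet.mem_nhds hx] with y hy
  refine ContinuousLinearMap.coe_injective (b.ext fun i ↦ ?_)
  simp [Finsupp.single_apply, ContinuousLinearMap.inCoordinates_eq hy hy,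
    t.localFrame_apply_of_mem_baseSet b hy, Trivialization.basisAt]
  rfl

variable [RiemannianBundle (fun (x : M) ↦ TangentSpace I x)]
  [IsContMDiffRiemannianBundle I ∞ E (fun (x : M) ↦ TangentSpace I x)]

/-- A vector field is smooth if its inner products with smooth vector fields are smooth. -/
theorem contMDiffAt_of_inner {Y : Π x : M, TangentSpace I x} {x : M}
    (h : ∀ Z : Π x : M, TangentSpace I x, CMDiffAt ∞ (T% Z) x →
      CMDiffAt ∞ (fun y ↦ (inner ℝ (Y y) (Z y) : ℝ)) x) :
    CMDiffAt ∞ (T% Y) x := by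
  set t := trivializationAt E (TangentSpace I (M := M)) x
  have hx : x ∈ t.baseSet := FiberBundle.mem_baseSet_trivializationAt' x
  let b := Module.finBasis ℝ E
  have hs := t.isLocalFrameOn_localFrame_baseSet I ∞ b
  set s := t.localFrame b
  have hsx : ∀ i, CMDiffAt ∞ (T% (s i)) x := fun i ↦ contMDiffAt_localFrame_of_mem ∞ t b i hx
  let A : M → (Fin (Module.finrank ℝ E) → ℝ) →L[ℝ] (Fin (Module.finrank ℝ E) → ℝ) :=
    fun y ↦ ∑ i, ∑ j, (inner ℝ (s j y) (s i y) : ℝ) •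
      (ContinuousLinearMap.proj (R := ℝ) (φ := fun _ : Fin (Module.finrank ℝ E) ↦ ℝ) j).smulRight
        (Pi.single i (1 : ℝ))
  have hA : ∀ y v i, A y v i = inner ℝ (∑ j, v j • s j y) (s i y) := fun y v i ↦ by
    simp [A, Finset.sum_apply, Pi.single_apply, sum_inner, real_inner_smul_left, mul_comm]
  have hAs : CMDiffAt ∞ A x := contMDiffAt_finsetSum fun i _ ↦ contMDiffAt_finsetSum fun j _ ↦
    ContMDiffAt.smul (ContMDiffAt.inner_bundle (F := E)
      (E := fun (x : M) ↦ TangentSpace I x) (hsx j) (hsx i)) contMDiffAt_const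
  have hinv : ∀ y ∈ t.baseSet, (A y).IsInvertible := fun y hy ↦ by
    have hinj : Function.Injective (A y).toLinearMap := by
      rw [← LinearMap.ker_eq_bot, LinearMap.ker_eq_bot']
      intro v hv
      have hv' : ∀ i, inner ℝ (∑ j, v j • s j y) (s i y) = 0 := fun i ↦ by
        rw [← hA]; exact congrFun hv i
      have h0 : ∑ j, v j • s j y = 0 := by
        rw [← inner_self_eq_zero (𝕜 := ℝ)]
        conv_lhs => rw [inner_sum]
        simp [real_inner_smul_right, hv']
      exact funext (Fintype.linearIndependent_iff.1 (hs.linearIndependent hy) v h0)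
    exact ⟨(LinearEquiv.ofInjectiveEndo _ hinj).toContinuousLinearEquiv, by ext; rfl⟩
  have hB : CMDiffAt ∞ (fun y ↦ (A y).inverse) x :=
    ((hinv x hx).contDiffAt_map_inverse.contMDiffAt).comp x hAs
  have hR : ContMDiffAt I 𝓘(ℝ, Fin (Module.finrank ℝ E) → ℝ) ∞
      (fun y ↦ fun i ↦ (inner ℝ (Y y) (s i y) : ℝ)) x :=
    contMDiffAt_pi_space.2 fun i ↦ h _ (hsx i)
  have hc := hB.clm_apply hR
  refine hs.contMDiffAt_of_coeff (fun i ↦ ?_) (t.open_baseSet.mem_nhds hx)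
  refine (contMDiffAt_pi_space.1 hc i).congr_of_eventuallyEq ?_
  filter_upwards [t.open_baseSet.mem_nhds hx] with y hy
  have : (fun i ↦ (inner ℝ (Y y) (s i y) : ℝ)) = A y (fun i ↦ hs.coeff i y (Y y)) := by
    ext i
    rw [hA, ← hs.coeff_sum_eq Y hy]
  rw [this, (hinv y hy).inverse_apply_self]
  rfl

end Smoothness

section LieDerivative

variable {E : Type*} [NormedAddCommGroup E] [NormedSpace ℝ E] [FiniteDimensional ℝ E]
  {H : Type*} [TopologicalSpace H] {I : ModelWithCorners ℝ E H}
  {M : Type*} [TopologicalSpace M] [ChartedSpace H M] [IsManifold I ∞ M]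

theorem minSmoothness_natCast_le_infty (n : ℕ) : minSmoothness ℝ n ≤ (∞ : WithTop ℕ∞) := by
  rw [minSmoothness_of_isRCLikeNormedField]
  exact_mod_cast le_top

theorem eventually_mdifferentiableAt {X : Π x : M, TangentSpace I x} {x : M}
    (hX : CMDiffAt ∞ (T% X) x) : ∀ᶠ y in 𝓝 x, MDiffAt (T% X) y :=
  ((contMDiffAt_iff_contMDiffAt_nhds (n := 1) (by simp)).1 (hX.of_le (by simp))).mono
    fun _ hy ↦ hy.mdifferentiableAt one_ne_zero

theorem contMDiffAt_mlieBracket {X Y : Π x : M, TangentSpace I x} {x : M}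
    (hX : CMDiffAt ∞ (T% X) x) (hY : CMDiffAt ∞ (T% Y) x) :
    CMDiffAt ∞ (T% (VectorField.mlieBracket I X Y)) x := by
  have : CompleteSpace E := FiniteDimensional.complete ℝ E
  have : IsManifold I (minSmoothness ℝ 2) M :=
    IsManifold.of_le (n := ∞) (minSmoothness_natCast_le_infty 2)
  have : IsManifold I (((⊤ : ℕ∞) : WithTop ℕ∞) + 1) M := ‹IsManifold I ∞ M›
  exact ContMDiffAt.mlieBracket_vectorField (m := ⊤) (n := ⊤) hX hY (by simp)

/-- The Lie bracket acts on smooth functions as the commutator of directional derivatives. -/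
theorem mvfderiv_mlieBracket {f : M → ℝ} {X Y : Π x : M, TangentSpace I x} {x : M}
    (hf : CMDiffAt ∞ f x) (hX : CMDiffAt ∞ (T% X) x) (hY : CMDiffAt ∞ (T% Y) x) :
    d% f x (VectorField.mlieBracket I X Y x) =
      d% (fun y ↦ d% f y (Y y)) x (X x) - d% (fun y ↦ d% f y (X y)) x (Y x) := by
  have : CompleteSpace E := FiniteDimensional.complete ℝ E
  have : IsManifold I (minSmoothness ℝ 3) M :=
    IsManifold.of_le (n := ∞) (minSmoothness_natCast_le_infty 3)
  have h2 : minSmoothness ℝ 2 ≤ (∞ : WithTop ℕ∞) := minSmoothness_natCast_le_infty 2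
  rcases subsingleton_or_nontrivial E with hE | hE
  · have : Subsingleton (TangentSpace I x) := hE
    simp [Subsingleton.elim (X x) 0, Subsingleton.elim (Y x) 0,
      Subsingleton.elim (VectorField.mlieBracket I X Y x) 0]
  have : Nontrivial (TangentSpace I x) := hE
  obtain ⟨v, hv⟩ := exists_ne (0 : TangentSpace I x)
  set Z : Π x : M, TangentSpace I x := FiberBundle.extend E v
  have hZv : Z x = v := by simp [Z]
  have hZ : CMDiffAt ∞ (T% Z) x := FiberBundle.contMDiffAt_extend ..
  have hfZ : CMDiffAt ∞ (T% (f • Z)) x := hf.smul_section hZ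
  have hfe : ∀ᶠ y in 𝓝 x, MDiffAt f y :=
    ((contMDiffAt_iff_contMDiffAt_nhds (n := 1) (by simp)).1 (hf.of_le (by simp))).mono
      fun _ hy ↦ hy.mdifferentiableAt one_ne_zero
  have hf1 := hfe.self_of_nhds
  have hZ1 := (eventually_mdifferentiableAt hZ).self_of_nhds
  have expand : ∀ U V : Π x : M, TangentSpace I x, CMDiffAt ∞ (T% U) x → CMDiffAt ∞ (T% V) x →
      VectorField.mlieBracket I U (VectorField.mlieBracket I V (f • Z)) x =
        (d% (fun y ↦ d% f y (V y)) x (U x) • Z x + d% f x (V x) • VectorField.mlieBracket I U Z x)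
        + (d% f x (U x) • VectorField.mlieBracket I V Z x
          + f x • VectorField.mlieBracket I U (VectorField.mlieBracket I V Z) x) := by
    intro U V hU hV
    have hVf := contMDiffAt_mvfderiv_apply hf hV
    have hVZ := contMDiffAt_mlieBracket hV hZ
    have heq : VectorField.mlieBracket I V (f • Z) =ᶠ[𝓝 x]
        (fun y ↦ d% f y (V y)) • Z + f • VectorField.mlieBracket I V Z := by
      filter_upwards [hfe, eventually_mdifferentiableAt hZ] with y hy hy'
      exact VectorField.mlieBracket_smul_right hy hy'
    rw [(EventuallyEq.refl _ U).mlieBracket_vectorField_eq heq,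
      VectorField.mlieBracket_add_right
        ((hVf.smul_section hZ).mdifferentiableAt (by simp))
        ((hf.smul_section hVZ).mdifferentiableAt (by simp)),
      VectorField.mlieBracket_smul_right (hVf.mdifferentiableAt (by simp)) hZ1,
      VectorField.mlieBracket_smul_right hf1 (hVZ.mdifferentiableAt (by simp))]
  have jac := VectorField.leibniz_identity_mlieBracket_apply (hX.of_le h2) (hY.of_le h2)
    (hfZ.of_le h2)
  rw [expand X Y hX hY, expand Y X hY hX, VectorField.mlieBracket_smul_right hf1 hZ1,
    VectorField.leibniz_identity_mlieBracket_apply (hX.of_le h2) (hY.of_le h2)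
    (hZ.of_le h2), hZv] at jac
  have h0 : (d% f x (VectorField.mlieBracket I X Y x) -
      (d% (fun y ↦ d% f y (Y y)) x (X x) - d% (fun y ↦ d% f y (X y)) x (Y x))) • v = 0 := by
    rw [← sub_eq_zero] at jac
    rw [← neg_eq_zero, ← jac]
    module
  exact sub_eq_zero.1 ((smul_eq_zero.1 h0).resolve_right hv)

end LieDerivative

section LeviCivita

variable {E : Type*} [NormedAddCommGroup E] [NormedSpace ℝ E] [FiniteDimensional ℝ E]
  {H : Type*} [TopologicalSpace H] {I : ModelWithCorners ℝ E H}
  {M : Type*} [TopologicalSpace M] [ChartedSpace H M] [IsManifold I ∞ M]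
  [RiemannianBundle (fun (x : M) ↦ TangentSpace I x)]

theorem inner_grad (ψ : M → ℝ) (x : M) (v : TangentSpace I x) :
    inner ℝ (grad I ψ x) v = d% ψ x v := by
  simp [grad]

variable [IsContMDiffRiemannianBundle I ∞ E (fun (x : M) ↦ TangentSpace I x)]

theorem contMDiffAt_inner {X Y : Π x : M, TangentSpace I x} {x : M}
    (hX : CMDiffAt ∞ (T% X) x) (hY : CMDiffAt ∞ (T% Y) x) :
    CMDiffAt ∞ (fun y ↦ (inner ℝ (X y) (Y y) : ℝ)) x :=
  ContMDiffAt.inner_bundle (F := E) (E := fun (x : M) ↦ TangentSpace I x) hX hY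

/-- The gradient of a smooth function is smooth. -/
theorem contMDiffAt_grad {ψ : M → ℝ} {x : M} (hψ : CMDiffAt ∞ ψ x) :
    CMDiffAt ∞ (T% (grad I ψ)) x :=
  contMDiffAt_of_inner fun Z hZ ↦ by
    simpa only [inner_grad] using contMDiffAt_mvfderiv_apply hψ hZ

/-- The covariant derivative of a smooth vector field along a smooth vector field is smooth. -/
theorem contMDiffAt_leviCivita_apply {X Y : Π x : M, TangentSpace I x} {x : M}
    (hX : CMDiffAt ∞ (T% X) x) (hY : CMDiffAt ∞ (T% Y) x) :
    CMDiffAt ∞ (T% (fun y ↦ leviCivita I M Y y (X y))) x := by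
  refine contMDiffAt_of_inner fun Z hZ ↦ ?_
  have hk : CMDiffAt ∞ (koszul Y X Z) x :=
    (((((contMDiffAt_mvfderiv_apply (contMDiffAt_inner hY hZ) hX).add
      (contMDiffAt_mvfderiv_apply (contMDiffAt_inner hZ hX) hY)).sub
      (contMDiffAt_mvfderiv_apply (contMDiffAt_inner hX hY) hZ)).add
      (contMDiffAt_inner (contMDiffAt_mlieBracket hX hY) hZ)).sub
      (contMDiffAt_inner (contMDiffAt_mlieBracket hX hZ) hY)).sub
      (contMDiffAt_inner (contMDiffAt_mlieBracket hY hZ) hX)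
  refine ((contMDiffAt_const (c := (1 / 2 : ℝ))).mul hk).congr_of_eventuallyEq ?_
  filter_upwards [eventually_mdifferentiableAt hX, eventually_mdifferentiableAt hY,
    eventually_mdifferentiableAt hZ] with y hXy hYy hZy
  have h : 2 * inner ℝ (leviCivita I M Y y (X y)) (Z y) = koszul Y X Z y :=
    two_inner_leviCivitaFun hXy hYy hZy
  simp only [Pi.mul_apply]
  linarith

/-- The covariant derivative of a smooth vector field is a smooth field of endomorphisms. -/
theorem endMDiffAt_leviCivita {Y : Π x : M, TangentSpace I x} {x : M}
    (hY : CMDiffAt ∞ (T% Y) x) : EndMDiffAt I (leviCivita I M Y) x :=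
  (contMDiffAt_end fun _ hV ↦ contMDiffAt_leviCivita_apply hV hY).mdifferentiableAt (by simp)

/-- The Hessian of a smooth function is symmetric. -/
theorem inner_hess_comm {ψ : M → ℝ} {x : M} (hψ : CMDiffAt ∞ ψ x) (v w : TangentSpace I x) :
    inner ℝ (hess I ψ x v) w = inner ℝ (hess I ψ x w) v := by
  set X : Π x : M, TangentSpace I x := FiberBundle.extend E v
  set Y : Π x : M, TangentSpace I x := FiberBundle.extend E w
  have hX : CMDiffAt ∞ (T% X) x := FiberBundle.contMDiffAt_extend ..
  have hY : CMDiffAt ∞ (T% Y) x := FiberBundle.contMDiffAt_extend ..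
  have hXv : X x = v := by simp [X]
  have hYw : Y x = w := by simp [Y]
  have hX1 := (eventually_mdifferentiableAt hX).self_of_nhds
  have hY1 := (eventually_mdifferentiableAt hY).self_of_nhds
  have hG1 := (eventually_mdifferentiableAt (contMDiffAt_grad hψ)).self_of_nhds
  have h1 := leviCivita_metric hX1 hG1 hY1
  have h2 := leviCivita_metric hY1 hG1 hX1
  have h3 := congrArg (fun u ↦ inner ℝ (grad I ψ x) u) (leviCivita_torsion hX1 hY1)
  simp only [inner_sub_right] at h3
  have h4 := mvfderiv_mlieBracket hψ hX hY
  rw [← inner_grad] at h4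
  simp only [inner_grad] at h1 h2 h3 h4
  rw [← hXv, ← hYw, hess]
  linarith

/-- The gradient of `|∇ψ|²` is `2 ∇²ψ(∇ψ)`. -/
theorem grad_norm_sq_grad {ψ : M → ℝ} {x : M} (hψ : CMDiffAt ∞ ψ x) :
    grad I (fun y ↦ ‖grad I ψ y‖ ^ 2) x = (2 : ℝ) • hess I ψ x (grad I ψ x) := by
  refine ext_inner_right ℝ fun v ↦ ?_
  set X : Π x : M, TangentSpace I x := FiberBundle.extend E v
  have hX : CMDiffAt ∞ (T% X) x := FiberBundle.contMDiffAt_extend ..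
  have hXv : X x = v := by simp [X]
  have hX1 := (eventually_mdifferentiableAt hX).self_of_nhds
  have hG1 := (eventually_mdifferentiableAt (contMDiffAt_grad hψ)).self_of_nhds
  have h1 := leviCivita_metric hX1 hG1 hG1
  have h2 := inner_hess_comm hψ (X x) (grad I ψ x)
  rw [inner_grad, real_inner_smul_left, ← hXv, ← h2]
  simp only [← real_inner_self_eq_norm_sq]
  rw [h1, real_inner_comm _ (grad I ψ x), hess]
  ring

/-- The Bochner formula for endomorphisms. -/
theorem half_hess_norm_sq_grad {ψ : M → ℝ} (hψ : ContMDiff I 𝓘(ℝ, ℝ) ∞ ψ) (x : M) :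
    (1 / 2 : ℝ) • hess I (fun y ↦ ‖grad I ψ y‖ ^ 2) x =
      covDerivEnd (hess I ψ) x (grad I ψ x) + hess I ψ x ∘L hess I ψ x
        + riemannEnd (grad I ψ) (grad I ψ) x := by
  have hG := contMDiffAt_grad (hψ x)
  have hG1 := (eventually_mdifferentiableAt hG).self_of_nhds
  have hS : EndMDiffAt I (hess I ψ) x := endMDiffAt_leviCivita hG
  have hgrad : grad I (fun y ↦ ‖grad I ψ y‖ ^ 2) =
      (2 : ℝ) • fun y ↦ hess I ψ y (grad I ψ y) :=
    funext fun y ↦ grad_norm_sq_grad (hψ y)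
  have hhess : hess I (fun y ↦ ‖grad I ψ y‖ ^ 2) x =
      (2 : ℝ) • leviCivita I M (fun y ↦ hess I ψ y (grad I ψ y)) x := by
    rw [hess, hgrad]
    exact (leviCivita I M).isCovariantDerivativeOnUniv.smul_const 2 (hS.apply hG1)
  ext v
  set V : Π x : M, TangentSpace I x := FiberBundle.extend E v
  have hVv : V x = v := by simp [V]
  have hV1 : MDiffAt (T% V) x := FiberBundle.mdifferentiableAt_extend ..
  rw [hhess, ← hVv]
  simp only [_root_.add_apply, _root_.smul_apply, ContinuousLinearMap.comp_apply]
  rw [covDerivEnd_apply hS _ hV1, riemannEnd_apply hS hV1, riemann,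
    ← leviCivita_torsion hG1 hV1, map_sub]
  simp only [hess, smul_smul]
  norm_num
  abel

end LeviCivita

end RiemannianGeometry

theorem mainTheorem4
    {E : Type*} [NormedAddCommGroup E] [NormedSpace ℝ E] [FiniteDimensional ℝ E]
    {H : Type*} [TopologicalSpace H] (I : ModelWithCorners ℝ E H)
    {M : Type*} [TopologicalSpace M] [ChartedSpace H M] [IsManifold I ∞ M]
    [BoundarylessManifold I M]
    [RiemannianBundle (fun x : M ↦ TangentSpace I x)]
    [IsContMDiffRiemannianBundle I ∞ E (fun x : M ↦ TangentSpace I x)]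
    (ψ : M → ℝ) (hψ : ContMDiff I 𝓘(ℝ, ℝ) ∞ ψ) (x : M) :
    -(1 / 2 : ℝ) • hess I (fun y ↦ ‖grad I ψ y‖ ^ 2) x
        + covDerivEnd (hess I ψ) x (grad I ψ x)
        + hess I ψ x ∘L hess I ψ x
        + riemannEnd (grad I ψ) (grad I ψ) x = 0
      ∧ tensorGamma2 I ψ x =
        hess I ψ x ∘L hess I ψ x + riemannEnd (grad I ψ) (grad I ψ) x := by
  have h := half_hess_norm_sq_grad hψ x
  constructor
  · rw [neg_smul, h]
    abel
  · rw [tensorGamma2, h]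
    abel
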